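/- Let $m,n\ge 0$ be integers, let $0<\lambda_1<\lambda_2<\dots<\lambda_m$ be real numbers and let $t_1,\dots,t_m\ge 1$ be integers with $\sum_{i=1}^m t_i=n$. For real numbers $c_1,\dots,c_n$ let $T(c_1,\dots,c_n)$ be the symmetric tridiagonal $n\times n$ matrix with diagonal entries $c_1+c_2,\,c_2+c_3,\,\dots,\,c_{n-1}+c_n,\,c_n$ and with entries $-c_2,\dots,-c_n$ directly above and directly below the diagonal. Then there exist real numbers $m_j>0$ (masses), $k_j>0$ (spring stiffnesses) and $b_j\ge 0$ (inertances), $j=1,\dots,n$, such that, with $M=\operatorname{diag}(m_1,\dots,m_n)$, $K=T(k_1,\dots,k_n)$ and $B=T(b_1,\dots,b_n)$ (the matrices of the fixed-free mass-spring-inerter chain), $$\prod_{i=1}^{m}(\lambda-\lambda_i)^{t_i}\;\Big|\;\det\bigl(K-\lambda(M+B)\bigr)\quad\text{in }\mathbb{R}[\lambda],$$ if and only if $t_i\le i$ for every $i=1,\dots,m$. -/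

import Mathlib

open Polynomial

/-- The tridiagonal matrix of the elements (springs or inerters) of a fixed-free chain of `n`
masses. The element with coefficient `c j` joins the mass `j - 1` (the ground, if `j` is the
first index) to the mass `j`, and nothing is attached beyond the last mass:
the diagonal entries are `c 1 + c 2, c 2 + c 3, …, c (n-1) + c n, c n`, and the entries next to
the diagonal are `- c 2, …, - c n` (indices from 1). -/
def chainMatrix {n : ℕ} (c : Fin n → ℝ) : Matrix (Fin n) (Fin n) ℝ :=
  Matrix.of fun i j =>
    if i = j then c i + (if h : (i : ℕ) + 1 < n then c ⟨(i : ℕ) + 1, h⟩ else 0)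
    else if (i : ℕ) + 1 = (j : ℕ) then - c j
    else if (j : ℕ) + 1 = (i : ℕ) then - c i
    else 0

/-- The characteristic polynomial `det (K - X (M + B))` of the matrix pencil of a fixed-free
mass-spring-inerter chain with masses `mass`, spring stiffnesses `k` and inertances `b`. -/
noncomputable def pencilDet {n : ℕ} (mass k b : Fin n → ℝ) : ℝ[X] :=
  ((chainMatrix k).map C - (X : ℝ[X]) • (Matrix.diagonal mass + chainMatrix b).map C).det

/-! The determinant is the numerator `U` of a continued fraction (`pencilDet_eq_chainPair`). With
`V` the companion denominator, built from the free end, a mass adds a constant to `V / U`, and an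
element adds `-X / (k - b X)` to `U / V`.

Necessity. Write `(U, V) = D (u, v)` with `u v' - u' v > 0` on the positive axis. A step of the
continued fraction keeps this form. The factor `D` grows only when the pole `p = k / b` of an
element hits a zero of the current denominator, and then `p` stays a zero of the new reduced
denominator. Zeros interlace (`card_zerosIn_le_of_wronskian_pos`), so the multiplicity of `l` in `D`
never exceeds the number of zeros of `v` in `(0, l]`, hence that of `u` in `(0, l)`
(`ReducedPair.attach`). As `u` has only simple positive zeros, a zero `l` of `U` has multiplicity at
most one more than the number of smaller positive zeros.

Sufficiency. Run the continued fraction backwards. Removing a pole `p` only in part costs a mass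
without lowering the degree and puts a factor `X - p` into `D`; the goal is `D ∏ (X - λ_i)` with
exponent `t_i - 1` of `λ_i` in `D`. Induct by adding the smallest zero: take a synthesis for `λ_2,
…, λ_m` with the positive exponents in `D` lowered by one, and insert a zero at `λ_1` and a pole at
`λ_1 + ε`. For small `ε` the old steps survive (`Synthesis.perturb`) and leave a first order
function with zero and pole near `λ_1`. From it one more partial step can be taken at each larger
`λ_i` (`Synthesis.exists_of_linear`), so the exponent of `λ_i` in `D` can reach `i - 1`. -/

open Filter Topology

/-! ### The determinant as the numerator of a continued fraction -/

/-- The numerator and denominator of the continued fraction of a fixed-free chain: the numerator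
is the determinant of the pencil, see `pencilDet_eq_chainPair`. -/
noncomputable def chainPair : (n : ℕ) → (mass k b : Fin n → ℝ) → ℝ[X] × ℝ[X]
  | 0, _, _, _ => (1, 0)
  | n + 1, mass, k, b =>
    let P := chainPair n (Fin.tail mass) (Fin.tail k) (Fin.tail b)
    ((C (k 0) - C (b 0) * X) * P.1 - X * (P.2 + C (mass 0) * P.1),
      (C (k 0) - C (b 0) * X) * (P.2 + C (mass 0) * P.1))

lemma chainPair_succ (n : ℕ) (mass k b : Fin (n + 1) → ℝ) :
    chainPair (n + 1) mass k b =
      ((C (k 0) - C (b 0) * X) * (chainPair n (Fin.tail mass) (Fin.tail k) (Fin.tail b)).1 -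
        X * ((chainPair n (Fin.tail mass) (Fin.tail k) (Fin.tail b)).2 +
          C (mass 0) * (chainPair n (Fin.tail mass) (Fin.tail k) (Fin.tail b)).1),
      (C (k 0) - C (b 0) * X) * ((chainPair n (Fin.tail mass) (Fin.tail k) (Fin.tail b)).2 +
          C (mass 0) * (chainPair n (Fin.tail mass) (Fin.tail k) (Fin.tail b)).1)) := rfl

/-- The polynomial matrix of the pencil of a chain. -/
noncomputable def pencilMatrix {n : ℕ} (mass k b : Fin n → ℝ) : Matrix (Fin n) (Fin n) ℝ[X] :=
  (chainMatrix k).map C - (X : ℝ[X]) • (Matrix.diagonal mass + chainMatrix b).map C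

lemma pencilMatrix_succ_succ {n : ℕ} (mass k b : Fin (n + 1) → ℝ) :
    (pencilMatrix mass k b).submatrix Fin.succ Fin.succ =
      pencilMatrix (Fin.tail mass) (Fin.tail k) (Fin.tail b) := by
  refine Matrix.ext fun i j => ?_
  simp [pencilMatrix, chainMatrix, Matrix.diagonal_apply, Fin.tail, Fin.succ_inj]

lemma pencilMatrix_zero_zero {n : ℕ} (mass k b : Fin (n + 2) → ℝ) :
    pencilMatrix mass k b 0 0 =
      (C (k 0) - C (b 0) * X) + (C (k 1) - C (b 1) * X) - C (mass 0) * X := by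
  have h : (⟨1, by omega⟩ : Fin (n + 2)) = 1 := rfl
  simp [pencilMatrix, chainMatrix, h]
  ring

lemma pencilMatrix_zero_one {n : ℕ} (mass k b : Fin (n + 2) → ℝ) :
    pencilMatrix mass k b 0 1 = -(C (k 1) - C (b 1) * X) := by
  simp [pencilMatrix, chainMatrix]
  ring

lemma pencilMatrix_one_zero {n : ℕ} (mass k b : Fin (n + 2) → ℝ) :
    pencilMatrix mass k b 1 0 = -(C (k 1) - C (b 1) * X) := by
  simp [pencilMatrix, chainMatrix]
  ring

lemma pencilMatrix_zero_succ_succ {n : ℕ} (mass k b : Fin (n + 2) → ℝ) (j : Fin n) :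
    pencilMatrix mass k b 0 j.succ.succ = 0 := by
  have h : (0 : Fin (n + 2)) ≠ j.succ.succ := (Fin.succ_ne_zero _).symm
  simp [pencilMatrix, chainMatrix, h]

lemma pencilMatrix_succ_succ_zero {n : ℕ} (mass k b : Fin (n + 2) → ℝ) (j : Fin n) :
    pencilMatrix mass k b j.succ.succ 0 = 0 := by
  simp [pencilMatrix, chainMatrix]

lemma pencilDet_zero (mass k b : Fin 0 → ℝ) : pencilDet mass k b = 1 := by
  simp [pencilDet]

lemma pencilDet_one (mass k b : Fin 1 → ℝ) :
    pencilDet mass k b = C (k 0) - C (b 0) * X - C (mass 0) * X := by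
  simp [pencilDet, chainMatrix]
  ring

lemma pencilDet_succ_succ {n : ℕ} (mass k b : Fin (n + 2) → ℝ) :
    pencilDet mass k b =
      ((C (k 0) - C (b 0) * X) + (C (k 1) - C (b 1) * X) - C (mass 0) * X) *
        pencilDet (Fin.tail mass) (Fin.tail k) (Fin.tail b) -
      (C (k 1) - C (b 1) * X) ^ 2 *
        pencilDet (Fin.tail (Fin.tail mass)) (Fin.tail (Fin.tail k)) (Fin.tail (Fin.tail b)) := by
  have key : ∀ {m : ℕ} (mass k b : Fin m → ℝ), pencilDet mass k b = (pencilMatrix mass k b).det :=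
    fun _ _ _ => rfl
  simp only [key]
  rw [Matrix.det_succ_row_zero, Fin.sum_univ_succ, Fin.sum_univ_succ]
  rw [Finset.sum_eq_zero fun j _ => by rw [pencilMatrix_zero_succ_succ]; ring]
  have h1 : ((pencilMatrix mass k b).submatrix Fin.succ (Fin.succAbove (Fin.succ 0))).det =
      -(C (k 1) - C (b 1) * X) * (pencilMatrix (Fin.tail (Fin.tail mass)) (Fin.tail (Fin.tail k))
        (Fin.tail (Fin.tail b))).det := by
    rw [Matrix.det_succ_column_zero, Fin.sum_univ_succ]
    rw [Finset.sum_eq_zero fun j _ => by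
      have : (pencilMatrix mass k b).submatrix Fin.succ (Fin.succAbove (Fin.succ 0)) j.succ 0 = 0 :=
        pencilMatrix_succ_succ_zero mass k b j
      rw [this]; ring]
    have h2 : (pencilMatrix mass k b).submatrix Fin.succ (Fin.succAbove (Fin.succ 0)) 0 0 =
        -(C (k 1) - C (b 1) * X) := pencilMatrix_one_zero mass k b
    have h3 : ((pencilMatrix mass k b).submatrix Fin.succ
        (Fin.succAbove (Fin.succ 0))).submatrix (Fin.succAbove 0) Fin.succ =
        pencilMatrix (Fin.tail (Fin.tail mass)) (Fin.tail (Fin.tail k)) (Fin.tail (Fin.tail b)) := by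
      rw [← pencilMatrix_succ_succ, ← pencilMatrix_succ_succ]
      refine Matrix.ext fun i j => ?_
      simp [Matrix.submatrix_apply]
    rw [h2, h3]
    simp
  have h4 : (pencilMatrix mass k b).submatrix Fin.succ (Fin.succAbove 0) =
      pencilMatrix (Fin.tail mass) (Fin.tail k) (Fin.tail b) := by
    rw [← pencilMatrix_succ_succ]
    simp
  have h5 : pencilMatrix mass k b 0 (Fin.succ 0) = -(C (k 1) - C (b 1) * X) :=
    pencilMatrix_zero_one mass k b
  rw [h1, h4, h5, pencilMatrix_zero_zero]
  simp
  ring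

theorem pencilDet_eq_chainPair : ∀ {n : ℕ} (mass k b : Fin n → ℝ),
    pencilDet mass k b = (chainPair n mass k b).1
  | 0, mass, k, b => by simp [pencilDet_zero, chainPair]
  | 1, mass, k, b => by
    rw [pencilDet_one]
    simp [chainPair]
  | n + 2, mass, k, b => by
    rw [pencilDet_succ_succ, pencilDet_eq_chainPair, pencilDet_eq_chainPair]
    have h : ∀ c : Fin (n + 2) → ℝ, Fin.tail c 0 = c 1 := fun _ => rfl
    simp only [chainPair, h]
    ring

lemma natDegree_chainPair_le : ∀ (n : ℕ) (mass k b : Fin n → ℝ),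
    (chainPair n mass k b).1.natDegree ≤ n ∧ (chainPair n mass k b).2.natDegree ≤ n
  | 0, _, _, _ => by simp [chainPair]
  | n + 1, mass, k, b => by
    obtain ⟨h1, h2⟩ := natDegree_chainPair_le n (Fin.tail mass) (Fin.tail k) (Fin.tail b)
    have hf : (C (k 0) - C (b 0) * X : ℝ[X]).natDegree ≤ 1 := by compute_degree
    have hY : ((chainPair n (Fin.tail mass) (Fin.tail k) (Fin.tail b)).2 +
        C (mass 0) * (chainPair n (Fin.tail mass) (Fin.tail k) (Fin.tail b)).1).natDegree ≤ n :=
      natDegree_add_le_of_degree_le h2 ((natDegree_C_mul_le _ _).trans h1)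
    have hX : (X : ℝ[X]).natDegree ≤ 1 := natDegree_X_le
    constructor
    · exact (natDegree_sub_le_of_le (natDegree_mul_le_of_le hf h1)
        (natDegree_mul_le_of_le hX hY)).trans (by omega)
    · exact (natDegree_mul_le_of_le hf hY).trans (by omega)

/-! ### Interlacing of zeros from a positive Wronskian -/

/-- If the quotient `v / g` is strictly increasing on the positive axis, positive at the origin and
finite there, then `g` vanishes between two consecutive zeros of `v`, the origin included. -/
lemma exists_root_between {g v : ℝ[X]} (hW : ∀ x, 0 < x → 0 < (wronskian g v).eval x)
    (h0 : 0 < g.eval 0 * v.eval 0) {s q : ℝ} (hs : 0 ≤ s) (hsq : s < q) (hq : v.eval q = 0)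
    (hsv : s = 0 ∨ v.eval s = 0) : ∃ z, s < z ∧ z < q ∧ g.eval z = 0 := by
  by_contra! hno
  have hends : ∀ x, 0 < x → v.eval x = 0 → g.eval x ≠ 0 := by
    intro x hx hv hg
    have := hW x hx
    simp [wronskian, hv, hg] at this
  have hg : ∀ x ∈ Set.Icc s q, g.eval x ≠ 0 := by
    rintro x ⟨h1, h2⟩
    rcases h1.eq_or_lt with rfl | h1
    · rcases hs.eq_or_lt with rfl | hs
      · intro h; simp [h] at h0
      · exact hends _ hs (hsv.resolve_left hs.ne')
    · rcases h2.eq_or_lt with rfl | h2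
      · exact hends _ (hs.trans_lt h1) hq
      · exact hno x h1 h2
  have hmono : StrictMonoOn (fun x => v.eval x / g.eval x) (Set.Icc s q) := by
    apply strictMonoOn_of_deriv_pos (convex_Icc s q)
    · exact v.continuous.continuousOn.div g.continuous.continuousOn hg
    · intro x hx
      rw [interior_Icc] at hx
      have hgx := hg x (Set.Ioo_subset_Icc_self hx)
      have hd : HasDerivAt (fun x => v.eval x / g.eval x) _ x :=
        (v.hasDerivAt x).div (g.hasDerivAt x) hgx
      rw [hd.deriv]
      have := hW x (hs.trans_lt hx.1)
      simp only [wronskian, eval_sub, eval_mul] at this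
      apply div_pos _ (by positivity)
      linarith
  have h := hmono (Set.left_mem_Icc.2 hsq.le) (Set.right_mem_Icc.2 hsq.le) hsq
  simp only [hq, zero_div] at h
  rcases hsv with rfl | hsv
  · have : 0 < v.eval 0 / g.eval 0 := by
      rw [← mul_div_mul_left _ _ (hg 0 (Set.left_mem_Icc.2 hsq.le))]
      exact div_pos h0 (mul_self_pos.2 (hg 0 (Set.left_mem_Icc.2 hsq.le)))
    linarith
  · simp [hsv] at h

/-- The distinct zeros of a polynomial that satisfy a given condition. -/
noncomputable def zerosIn (v : ℝ[X]) (s : Set ℝ) : Finset ℝ := by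
  classical exact v.roots.toFinset.filter (· ∈ s)

lemma mem_zerosIn {v : ℝ[X]} (hv : v ≠ 0) {s : Set ℝ} {x : ℝ} :
    x ∈ zerosIn v s ↔ v.eval x = 0 ∧ x ∈ s := by
  classical
  simp [zerosIn, hv]

/-- Each zero `q` of `v` is matched with a zero of `g` in the gap just below `q`; the gaps are
disjoint, so the matching is injective. The right end `l` is lost on the side of `g`, which is what
pays for a new common factor at `l`. -/
lemma card_zerosIn_le_of_wronskian_pos {g v : ℝ[X]}
    (hW : ∀ x, 0 < x → 0 < (wronskian g v).eval x) (h0 : 0 < g.eval 0 * v.eval 0) (l : ℝ) :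
    (zerosIn v (Set.Ioc 0 l)).card ≤ (zerosIn g (Set.Ioo 0 l)).card := by
  classical
  have hg0 : g ≠ 0 := by rintro rfl; simp at h0
  have hv0 : v ≠ 0 := by rintro rfl; simp at h0
  have key : ∀ q ∈ zerosIn v (Set.Ioc 0 l), ∃ z ∈ zerosIn g (Set.Ioo 0 l), z < q ∧
      ∀ q' ∈ zerosIn v (Set.Ioc 0 l), q' < q → q' < z := by
    intro q hq
    obtain ⟨hvq, hq0, hql⟩ := (mem_zerosIn hv0).1 hq
    -- The origin serves as the left end of the gap below the smallest zero.
    set T := insert 0 ((zerosIn v (Set.Ioc 0 l)).filter (· < q)) with hT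
    have hTne : T.Nonempty := ⟨0, Finset.mem_insert_self _ _⟩
    have hmem := T.max'_mem hTne
    have hs0 : 0 ≤ T.max' hTne := T.le_max' 0 (Finset.mem_insert_self _ _)
    have hcase : T.max' hTne = 0 ∨ (v.eval (T.max' hTne) = 0 ∧ T.max' hTne < q) := by
      rcases Finset.mem_insert.1 hmem with h | h
      · exact Or.inl h
      · rw [Finset.mem_filter, mem_zerosIn hv0] at h
        exact Or.inr ⟨h.1.1, h.2⟩
    obtain ⟨z, h1, h2, h3⟩ := exists_root_between hW h0 hs0
      (hcase.elim (fun h => h ▸ hq0) (fun h => h.2)) hvq (hcase.imp_right And.left)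
    refine ⟨z, (mem_zerosIn hg0).2 ⟨h3, hs0.trans_lt h1, h2.trans_le hql⟩, h2, ?_⟩
    intro q' hq' hlt
    exact (T.le_max' q' (Finset.mem_insert_of_mem (Finset.mem_filter.2 ⟨hq', hlt⟩))).trans_lt h1
  choose! f hf1 hf2 hf3 using key
  apply Finset.card_le_card_of_injOn f hf1
  intro a ha b hb hab
  by_contra hne
  rcases lt_or_gt_of_ne hne with h | h
  · exact lt_irrefl _ ((hab ▸ hf2 a ha : f b < a).trans (hf3 b hb a ha h))
  · exact lt_irrefl _ ((hab.symm ▸ hf2 b hb : f a < b).trans (hf3 a ha b hb h))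

/-! ### Necessity: multiplicities along the chain -/

/-- `(U, V)` is the product of a polynomial `D` and a pair of polynomials whose quotient is strictly
decreasing; the multiplicity of `l` as a zero of `D` is bounded by the number of zeros of the
denominator in `(0, l]`. -/
def ReducedPair (l : ℝ) (U V : ℝ[X]) : Prop :=
  ∃ D u v : ℝ[X], D ≠ 0 ∧ U = D * u ∧ V = D * v ∧ 0 < u.eval 0 ∧ 0 < v.eval 0 ∧
    (∀ x, 0 < x → 0 < (wronskian u v).eval x) ∧
    D.rootMultiplicity l ≤ (zerosIn v (Set.Ioc 0 l)).card

lemma zerosIn_card_mono {v w : ℝ[X]} (hv : v ≠ 0) (hw : w ≠ 0) {s t : Set ℝ} (hst : s ⊆ t)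
    (h : ∀ x, v.eval x = 0 → w.eval x = 0) :
    (zerosIn v s).card ≤ (zerosIn w t).card := by
  apply Finset.card_le_card
  intro x hx
  rw [mem_zerosIn hv] at hx
  exact (mem_zerosIn hw).2 ⟨h x hx.1, hst hx.2⟩

/-- Attaching an element with coefficients `k` and `b` to a reduced pair. -/
lemma ReducedPair.attach {l : ℝ} (hl : 0 < l) {D u y : ℝ[X]} (hD : D ≠ 0) (hu : 0 < u.eval 0)
    (hy : 0 < y.eval 0) (hW : ∀ x, 0 < x → 0 ≤ (wronskian u y).eval x)
    (hWy : ∀ x, 0 < x → y.eval x = 0 → 0 < (wronskian u y).eval x)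
    (hmult : D.rootMultiplicity l ≤ (zerosIn y (Set.Ioo 0 l)).card) {k b : ℝ} (hk : 0 < k)
    (hb : 0 ≤ b) :
    ReducedPair l ((C k - C b * X) * (D * u) - X * (D * y)) ((C k - C b * X) * (D * y)) := by
  classical
  have hy0 : y ≠ 0 := by rintro rfl; simp at hy
  have hf0 : (C k - C b * X : ℝ[X]) ≠ 0 := by
    intro h
    have := congrArg (eval 0) h
    simp at this
    exact hk.ne' this
  -- A new common factor appears exactly when the pole `p = k / b` of the element is a zero of `y`.
  by_cases hc : ∃ p, k = b * p ∧ y.eval p = 0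
  · obtain ⟨p, rfl, hp⟩ := hc
    have hb' : 0 < b := hb.lt_of_ne (by rintro rfl; simp at hk)
    have hp0 : 0 < p := pos_of_mul_pos_right hk hb
    obtain ⟨w, rfl⟩ := dvd_iff_isRoot.2 hp
    have hX : (X - C p : ℝ[X]) ≠ 0 := X_sub_C_ne_zero p
    have hw0 : w ≠ 0 := right_ne_zero_of_mul hy0
    refine ⟨-(D * (X - C p)), C b * u + X * w, C b * ((X - C p) * w),
      neg_ne_zero.2 (mul_ne_zero hD hX), by simp only [C_mul]; ring, by simp only [C_mul]; ring,
      by simpa using mul_pos hb' hu, by rw [eval_mul, eval_C]; exact mul_pos hb' hy, ?_, ?_⟩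
    · intro x hx
      have h1 : (wronskian (C b * u + X * w) (C b * ((X - C p) * w))).eval x =
          b ^ 2 * (wronskian u ((X - C p) * w)).eval x + b * p * w.eval x ^ 2 := by
        simp [wronskian]
        ring
      rw [h1]
      by_cases hyx : ((X - C p) * w).eval x = 0
      · exact add_pos_of_pos_of_nonneg (mul_pos (pow_pos hb' 2) (hWy x hx hyx))
          (mul_nonneg hk.le (sq_nonneg _))
      · have hwx : w.eval x ≠ 0 := fun h => hyx (by simp [h])
        exact add_pos_of_nonneg_of_pos (mul_nonneg (sq_nonneg _) (hW x hx))
          (mul_pos hk (sq_pos_of_ne_zero hwx))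
    · have hneg : (-(D * (X - C p))).rootMultiplicity l =
          D.rootMultiplicity l + (if l = p then 1 else 0) := by
        have : -(D * (X - C p)) = D * (X - C p) * C (-1) := by simp
        rw [this, rootMultiplicity_mul (mul_ne_zero (mul_ne_zero hD hX) (by simp)),
          rootMultiplicity_mul (mul_ne_zero hD hX), rootMultiplicity_C,
          rootMultiplicity_X_sub_C, add_zero]
      have hby : C b * ((X - C p) * w) ≠ 0 := mul_ne_zero (by simpa using hb'.ne') hy0
      rw [hneg]
      split_ifs with hlp
      · subst hlp
        -- The multiplicity of `l` rises by one, but `l` itself is a zero counted in `(0, l]` and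
        -- not in `(0, l)`.
        rw [Nat.add_one_le_iff]
        refine hmult.trans_lt (Finset.card_lt_card ?_)
        rw [Finset.ssubset_iff_of_subset]
        · refine ⟨l, ?_, ?_⟩
          · rw [mem_zerosIn hby]
            simp [hl]
          · rw [mem_zerosIn hy0]
            simp
        · intro x hx
          rw [mem_zerosIn hy0] at hx
          rw [mem_zerosIn hby, eval_mul, hx.1]
          exact ⟨by simp, Set.Ioo_subset_Ioc_self hx.2⟩
      · rw [add_zero]
        exact hmult.trans (zerosIn_card_mono hy0 hby
          Set.Ioo_subset_Ioc_self fun x hx => by rw [eval_mul, hx, mul_zero])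
  · push Not at hc
    refine ⟨D, (C k - C b * X) * u - X * y, (C k - C b * X) * y, hD, by ring, by ring,
      by simpa using mul_pos hk hu, by simpa using mul_pos hk hy, ?_, ?_⟩
    · intro x hx
      have h1 : (wronskian ((C k - C b * X) * u - X * y) ((C k - C b * X) * y)).eval x =
          (k - b * x) ^ 2 * (wronskian u y).eval x + k * y.eval x ^ 2 := by
        simp [wronskian]
        ring
      rw [h1]
      by_cases hyx : y.eval x = 0
      · have h2 : k - b * x ≠ 0 := fun h => hc x (sub_eq_zero.1 h) hyx
        exact add_pos_of_pos_of_nonneg (mul_pos (sq_pos_of_ne_zero h2) (hWy x hx hyx))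
          (mul_nonneg hk.le (sq_nonneg _))
      · exact add_pos_of_nonneg_of_pos (mul_nonneg (sq_nonneg _) (hW x hx))
          (mul_pos hk (sq_pos_of_ne_zero hyx))
    · refine hmult.trans (zerosIn_card_mono hy0 (mul_ne_zero hf0 hy0)
        Set.Ioo_subset_Ioc_self fun x hx => by simp [hx])

/-- Induction from the free end towards the ground. A mass trades the count of zeros in `(0, l]` for
one in `(0, l)` by interlacing; the next element turns it back into a count in `(0, l]`. -/
lemma reducedPair_chainPair {l : ℝ} (hl : 0 < l) : ∀ (n : ℕ) (mass k b : Fin (n + 1) → ℝ),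
    (∀ j, 0 < mass j) → (∀ j, 0 < k j) → (∀ j, 0 ≤ b j) →
    ReducedPair l (chainPair (n + 1) mass k b).1 (chainPair (n + 1) mass k b).2
  | 0, mass, k, b, hm, hk, hb => by
    -- For a single mass the Wronskian vanishes identically; strictness is needed only at zeros of
    -- `y`, and a positive constant has none.
    have := ReducedPair.attach hl (D := 1) (u := 1) (y := C (mass 0)) one_ne_zero (by simp)
      (by simpa using hm 0) (by simp [wronskian]) (by intro x _ h; simp [(hm 0).ne'] at h)
      (by rw [← C_1, rootMultiplicity_C]; exact Nat.zero_le _) (hk 0) (hb 0)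
    rw [chainPair_succ]
    simpa [chainPair] using this
  | n + 1, mass, k, b, hm, hk, hb => by
    obtain ⟨D, u, v, hD, hU, hV, hu, hv, hW, hmult⟩ := reducedPair_chainPair hl n
      (Fin.tail mass) (Fin.tail k) (Fin.tail b) (fun j => hm _) (fun j => hk _) (fun j => hb _)
    have hWy : wronskian u (v + C (mass 0) * u) = wronskian u v := by
      simp [wronskian]
      ring
    have hWyv : wronskian (v + C (mass 0) * u) v = C (mass 0) * wronskian u v := by
      simp [wronskian]
      ring
    have hm0 := hm 0
    have hy : 0 < (v + C (mass 0) * u).eval 0 := by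
      rw [eval_add, eval_mul, eval_C]
      exact add_pos hv (mul_pos hm0 hu)
    have := ReducedPair.attach hl (y := v + C (mass 0) * u) hD hu hy
      (fun x hx => hWy ▸ (hW x hx).le) (fun x hx _ => hWy ▸ hW x hx)
      (hmult.trans (card_zerosIn_le_of_wronskian_pos (fun x hx => by
        rw [hWyv, eval_mul, eval_C]; exact mul_pos hm0 (hW x hx)) (mul_pos hy hv) l))
      (hk 0) (hb 0)
    rw [chainPair_succ, hU, hV]
    convert this using 1 <;> ring

/-- The multiplicity of a zero of a reduced pair exceeds the number of smaller zeros by at most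
one. -/
lemma ReducedPair.rootMultiplicity_le {l : ℝ} (hl : 0 < l) {U V : ℝ[X]} (h : ReducedPair l U V) :
    U ≠ 0 ∧ U.rootMultiplicity l ≤ (zerosIn U (Set.Ioo 0 l)).card + 1 := by
  obtain ⟨D, u, v, hD, rfl, rfl, hu, hv, hW, hmult⟩ := h
  have hu0 : u ≠ 0 := by rintro rfl; simp at hu
  have hDu : D * u ≠ 0 := mul_ne_zero hD hu0
  refine ⟨hDu, ?_⟩
  rw [rootMultiplicity_mul hDu]
  have h1 := card_zerosIn_le_of_wronskian_pos hW (mul_pos hu hv) l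
  have h2 : (zerosIn u (Set.Ioo 0 l)).card ≤ (zerosIn (D * u) (Set.Ioo 0 l)).card :=
    zerosIn_card_mono hu0 hDu subset_rfl fun x hx => by simp [hx]
  -- A double zero of `u` at `l` would make the Wronskian vanish there.
  have h3 : u.rootMultiplicity l ≤ 1 := by
    by_contra! hgt
    have h4 := (one_lt_rootMultiplicity_iff_isRoot hu0).1 hgt
    have := hW l hl
    simp [wronskian, h4.1.eq_zero, h4.2.eq_zero] at this
  omega

theorem multiplicity_le_of_dvd_pencilDet {m n : ℕ} {lam : Fin m → ℝ} {t : Fin m → ℕ}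
    (hpos : ∀ i, 0 < lam i) (hlam : StrictMono lam) (ht : ∀ i, 1 ≤ t i) (hsum : ∑ i, t i = n)
    {mass k b : Fin n → ℝ} (hm : ∀ j, 0 < mass j) (hk : ∀ j, 0 < k j) (hb : ∀ j, 0 ≤ b j)
    (hdvd : ∏ i, (X - C (lam i)) ^ t i ∣ pencilDet mass k b) (i : Fin m) :
    t i ≤ (i : ℕ) + 1 := by
  classical
  have hn : 0 < n := by
    rw [← hsum]
    exact (ht i).trans (Finset.single_le_sum (fun j _ => Nat.zero_le (t j)) (Finset.mem_univ i))
  obtain ⟨n, rfl⟩ := Nat.exists_eq_succ_of_ne_zero hn.ne'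
  have hdeg := (natDegree_chainPair_le _ mass k b).1
  obtain ⟨hU, hmult⟩ :=
    (reducedPair_chainPair (hpos i) n mass k b hm hk hb).rootMultiplicity_le (hpos i)
  rw [← pencilDet_eq_chainPair] at hU hmult hdeg
  have hmonic : (∏ i, (X - C (lam i)) ^ t i).Monic :=
    monic_prod_of_monic _ _ fun j _ => (monic_X_sub_C _).pow _
  have hdegP : (∏ i, (X - C (lam i)) ^ t i).natDegree = n + 1 := by
    rw [natDegree_prod_of_monic _ _ fun j _ => (monic_X_sub_C _).pow _]
    simpa using hsum
  obtain ⟨q, hq⟩ := hdvd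
  have hq0 : q ≠ 0 := by rintro rfl; simp [hq] at hU
  -- The divisor already has the full degree, so the determinant has no zeros besides the prescribed
  -- ones.
  have hqdeg : q.natDegree = 0 := by
    rw [hq, hmonic.natDegree_mul' hq0, hdegP] at hdeg
    omega
  obtain ⟨c, rfl⟩ := natDegree_eq_zero.1 hqdeg
  have h1 : t i ≤ (pencilDet mass k b).rootMultiplicity (lam i) := by
    rw [le_rootMultiplicity_iff hU, hq]
    exact (Finset.dvd_prod_of_mem (fun j => (X - C (lam j)) ^ t j) (Finset.mem_univ i)).mul_right _
  have h2 : zerosIn (pencilDet mass k b) (Set.Ioo 0 (lam i)) ⊆ (Finset.Iio i).image lam := by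
    intro x hx
    obtain ⟨hx0, -, hxl⟩ := (mem_zerosIn hU).1 hx
    rw [hq, eval_mul, eval_C, mul_eq_zero, eval_prod, Finset.prod_eq_zero_iff] at hx0
    obtain ⟨j, -, hj⟩ := hx0.resolve_right (by simpa using hq0)
    have hxj : x = lam j := by
      have := eq_zero_of_pow_eq_zero (by simpa using hj : (x - lam j) ^ t j = 0)
      linarith
    subst hxj
    exact Finset.mem_image_of_mem _ (Finset.mem_Iio.2 (hlam.lt_iff_lt.1 hxl))
  have h3 := (Finset.card_le_card h2).trans Finset.card_image_le
  rw [Fin.card_Iio] at h3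
  omega

/-! ### Successive synthesis with full and partial removal of poles -/

/-- The chain of length `n` has, up to a common constant, the pair of polynomials `(u, v)`. -/
def ChainRealizes (n : ℕ) (u v : ℝ[X]) : Prop :=
  ∃ mass k b : Fin n → ℝ, (∀ j, 0 < mass j) ∧ (∀ j, 0 < k j) ∧ (∀ j, 0 ≤ b j) ∧
    ∃ c : ℝ, c ≠ 0 ∧ chainPair n mass k b = (C c * u, C c * v)

/-- One backward step: the mass makes the denominator `w`, and the element with `k = p / g`, `b = 1
/ g` contributes `g X / (X - p)` to the quotient. -/
lemma ChainRealizes.cons {n : ℕ} {m g p : ℝ} {u w : ℝ[X]} (hm : 0 < m) (hg : 0 < g) (hp : 0 < p)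
    (h : ChainRealizes n u (w - C m * u)) :
    ChainRealizes (n + 1) ((X - C p) * u + C g * X * w) ((X - C p) * w) := by
  obtain ⟨mass, k, b, h1, h2, h3, c, hc, h4⟩ := h
  refine ⟨Fin.cons m mass, Fin.cons (p / g) k, Fin.cons (1 / g) b, ?_, ?_, ?_, -(c / g),
    neg_ne_zero.2 (div_ne_zero hc hg.ne'), ?_⟩
  · exact Fin.cases hm h1
  · exact Fin.cases (div_pos hp hg) h2
  · exact Fin.cases (div_pos one_pos hg).le h3
  · have e1 : (C (p / g) : ℝ[X]) = C p * C (1 / g) := by rw [← C_mul]; ring_nf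
    have e2 : (C (-(c / g)) : ℝ[X]) = -(C c * C (1 / g)) := by
      rw [← C_mul, ← C_neg]; ring_nf
    have e3 : (C (1 / g) * C g : ℝ[X]) = 1 := by
      rw [← C_mul, one_div_mul_cancel hg.ne', C_1]
    rw [chainPair_succ]
    simp only [Fin.tail_cons, Fin.cons_zero, h4, e1, e2]
    ext1
    · linear_combination (X * C c * w) * e3
    · ring

/-- The conditions on a state of the synthesis: `u / ((X - p) w)` is the function still to be
realized, the element to be split off next has its pole at `p`. -/
structure Admissible (Z : Finset ℝ) (d : ℕ) (p : ℝ) (u w : ℝ[X]) : Prop where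
  pos : 0 < p
  lt : ∀ y ∈ Z, y < p
  num_ne : u.eval p ≠ 0
  den_ne : w.eval p ≠ 0
  natDegree_num : u.natDegree ≤ d + 1
  natDegree_den : w.natDegree ≤ d
  neg : ∀ y ∈ Z, u.eval y * w.eval y < 0

/-- Successive synthesis of `u / ((X - p) w)` as a chain with `n` masses. In each step the pole at
`p` is split off, in full or in part, and then a mass, so that the next pole is at `q`. The
factors of `D` belong to the partial steps. -/
inductive Synthesis (Z : Finset ℝ) : ℕ → ℝ[X] → ℕ → ℝ → ℝ[X] → ℝ[X] → Prop
  | last {a c g p : ℝ} {u : ℝ[X]} (hac : 0 < a * c) (hg : 0 < g)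
      (hu : u = (X - C p) * C a + C g * X * C c) (hA : Admissible Z 0 p u (C c)) :
      Synthesis Z 0 1 1 p u (C c)
  | full {d n : ℕ} {D u w u' w' : ℝ[X]} {m g p q : ℝ} (hm : 0 < m) (hg : 0 < g)
      (hu : u = (X - C p) * u' + C g * X * w) (hw : w = C m * u' + (X - C q) * w')
      (hA : Admissible Z (d + 1) p u w) (h : Synthesis Z d D n q u' w') :
      Synthesis Z (d + 1) D (n + 1) p u w
  | part {d n : ℕ} {D u w u' w' : ℝ[X]} {m g p q : ℝ} (hm : 0 < m) (hg : 0 < g)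
      (hu : u = u' + C g * X * w) (hw : (X - C p) * w = C m * u' + (X - C q) * w')
      (hA : Admissible Z d p u w) (h : Synthesis Z d D n q u' w') :
      Synthesis Z d ((X - C p) * D) (n + 1) p u w

namespace Synthesis

variable {Z : Finset ℝ} {d n : ℕ} {D u w : ℝ[X]} {p : ℝ}

lemma admissible (h : Synthesis Z d D n p u w) : Admissible Z d p u w := by
  cases h <;> assumption

lemma monic (h : Synthesis Z d D n p u w) : D.Monic := by
  induction h with
  | last => exact monic_one
  | full _ _ _ _ _ _ ih => exact ih
  | part _ _ _ _ _ _ ih => exact (monic_X_sub_C _).mul ih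

/-- A full step lowers `d` by one, a partial step lowers the degree of `D` by one, and the last step
accounts for the remaining mass. -/
lemma length_eq (h : Synthesis Z d D n p u w) : n = D.natDegree + d + 1 := by
  induction h with
  | last => simp
  | full _ _ _ _ _ _ ih => omega
  | part _ _ _ _ _ h ih =>
    rw [(monic_X_sub_C _).natDegree_mul h.monic, natDegree_X_sub_C]
    omega

/-- In a partial step the remainder still has the denominator `(X - p) w`. Adding the element with
the same pole multiplies by `X - p` once more, and this surplus is common to numerator and
denominator: it is the new factor of `D`. -/
lemma chainRealizes (h : Synthesis Z d D n p u w) :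
    ChainRealizes n (D * u) (D * ((X - C p) * w)) := by
  induction h with
  | @last a c g p u hac hg hu hA =>
    have ha : a ≠ 0 := left_ne_zero_of_mul hac.ne'
    have hm : 0 < c / a := by
      rw [← mul_div_mul_right _ _ ha, mul_comm c a]
      exact div_pos hac (mul_self_pos.2 ha)
    have h0 : ChainRealizes 0 (C a) (C c - C (c / a) * C a) := by
      refine ⟨Fin.elim0, Fin.elim0, Fin.elim0, fun j => j.elim0, fun j => j.elim0,
        fun j => j.elim0, a⁻¹, inv_ne_zero ha, ?_⟩
      simp only [chainPair, ← C_mul, ← C_sub]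
      rw [inv_mul_cancel₀ ha, div_mul_cancel₀ _ ha]
      simp
    have := h0.cons hm hg hA.pos
    rwa [one_mul, one_mul, hu]
  | @full d n D u w u' w' m g p q hm hg hu hw hA h ih =>
    have h0 : ChainRealizes n (D * u') (D * w - C m * (D * u')) := by
      convert ih using 1
      linear_combination D * hw
    convert h0.cons hm hg hA.pos using 1
    · rw [hu]; ring
    · ring
  | @part d n D u w u' w' m g p q hm hg hu hw hA h ih =>
    have h0 : ChainRealizes n (D * u') (D * ((X - C p) * w) - C m * (D * u')) := by
      convert ih using 1
      linear_combination D * hw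
    convert h0.cons hm hg hA.pos using 1
    · rw [hu]; ring
    · ring

/-- A first order function `a (X - z) / (c (X - p))` is synthesized with partial steps at arbitrary
increasing positions beyond `p`. -/
lemma exists_of_linear (Z : Finset ℝ) (f : ℝ) (l : List ℝ) : ∀ {a c z p : ℝ}, 0 < a * c → 0 < z →
    z < p → p < f → (∀ y ∈ Z, y < z) → (∀ s ∈ l, p < s ∧ s < f) → l.Pairwise (· < ·) →
    ∃ (q m : ℝ) (w : ℝ[X]), 0 < m ∧
      C c * (X - C p) = C m * (C a * (X - C z)) + (X - C q) * w ∧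
      Synthesis Z 0 (l.map fun s => X - C s).prod (l.length + 1) q (C a * (X - C z)) w := by
  -- Splitting off a mass moves the pole from `p` to any prescribed `q > p`: the mass is determined
  -- by the vanishing of the remainder at `q`.
  have move : ∀ {a c z p q : ℝ}, 0 < a * c → 0 < z → z < p → p < q → (∀ y ∈ Z, y < z) →
      ∃ m e : ℝ, 0 < m ∧ 0 < a * e ∧
        C c * (X - C p) = C m * (C a * (X - C z)) + (X - C q) * C e ∧
        Admissible Z 0 q (C a * (X - C z)) (C e) := by
    intro a c z p q hac hz hzp hpq hZ
    have ha : a ≠ 0 := left_ne_zero_of_mul hac.ne'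
    have hc : c ≠ 0 := right_ne_zero_of_mul hac.ne'
    have hqz : 0 < q - z := by linarith
    have hae : 0 < a * (c * ((p - z) / (q - z))) := by
      rw [← mul_assoc]
      exact mul_pos hac (div_pos (by linarith) hqz)
    refine ⟨c / a * ((q - p) / (q - z)), c * ((p - z) / (q - z)), ?_, hae, ?_, ?_⟩
    · refine mul_pos ?_ (div_pos (by linarith) hqz)
      rw [← mul_div_mul_left _ _ ha]
      exact div_pos hac (mul_self_pos.2 ha)
    · apply Polynomial.funext
      intro x
      simp
      field_simp
      ring
    · refine ⟨by linarith, fun y hy => by linarith [hZ y hy], ?_, ?_, ?_, (natDegree_C _).le, ?_⟩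
      · simpa [ha] using hqz.ne'
      · simpa using right_ne_zero_of_mul hae.ne'
      · rw [natDegree_C_mul ha, natDegree_X_sub_C]
      · intro y hy
        have := hZ y hy
        simp only [eval_mul, eval_C, eval_sub, eval_X]
        have : 0 < (z - y) * (a * (c * ((p - z) / (q - z)))) := mul_pos (by linarith) hae
        linarith
  induction l with
  | nil =>
    intro a c z p hac hz hzp hpf hZ _ _
    obtain ⟨m, e, hm, hae, he, hA⟩ := move hac hz hzp hpf hZ
    refine ⟨f, m, C e, hm, he, ?_⟩
    have hf : 0 < f := hA.pos
    have ha : a ≠ 0 := left_ne_zero_of_mul hae.ne'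
    have he0 : e ≠ 0 := right_ne_zero_of_mul hae.ne'
    have hg : 0 < a / e * ((f - z) / f) := by
      refine mul_pos ?_ (div_pos (by linarith) hf)
      rw [← mul_div_mul_right _ _ he0]
      exact div_pos hae (mul_self_pos.2 he0)
    -- The constants solve `a (X - z) = a' (X - f) + g e X`, with `a'` read off at the origin and
    -- `g` at `f`.
    refine Synthesis.last (a := a * (z / f)) (g := a / e * ((f - z) / f)) ?_ hg ?_ hA
    · have := mul_pos hae (div_pos hz hf)
      linarith
    · apply Polynomial.funext
      intro x
      simp
      field_simp
      ring
  | cons q l ih =>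
    intro a c z p hac hz hzp hpf hZ hl hl'
    obtain ⟨hpq, hqf⟩ := hl q (by simp)
    obtain ⟨m, e, hm, hae, he, hA⟩ := move hac hz hzp hpq hZ
    have hq : 0 < q := hA.pos
    have ha : a ≠ 0 := left_ne_zero_of_mul hae.ne'
    have he0 : e ≠ 0 := right_ne_zero_of_mul hae.ne'
    have hqz : 0 < q + z := by linarith
    -- The partial step at `q` moves the zero from `z` to the harmonic mean of `z` and `q`; any
    -- point strictly between them would do, leaving room for the following steps.
    have h1 : z < 2 * q * z / (q + z) := by
      rw [lt_div_iff₀ hqz]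
      nlinarith
    have h2 : 2 * q * z / (q + z) < q := by
      rw [div_lt_iff₀ hqz]
      nlinarith
    have h3 : 0 < a * ((q + z) / (2 * q)) * e := by
      have := mul_pos hae (div_pos hqz (by linarith : 0 < 2 * q))
      linarith
    rw [List.pairwise_cons] at hl'
    obtain ⟨q', m', w', hm', hw', hS⟩ := ih h3 (hz.trans h1) h2 hqf
      (fun y hy => (hZ y hy).trans h1)
      (fun s hs => ⟨hl'.1 s hs, (hl s (List.mem_cons_of_mem _ hs)).2⟩) hl'.2
    refine ⟨q, m, C e, hm, he, ?_⟩
    have hg : 0 < a / e * ((q - z) / (2 * q)) := by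
      refine mul_pos ?_ (div_pos (by linarith) (by linarith))
      rw [← mul_div_mul_right _ _ he0]
      exact div_pos hae (mul_self_pos.2 he0)
    rw [List.map_cons, List.prod_cons, List.length_cons]
    refine Synthesis.part (g := a / e * ((q - z) / (2 * q))) hm' hg ?_ ?_ hA hS
    · apply Polynomial.funext
      intro x
      simp
      field_simp
      ring
    · rw [← hw', mul_comm]

end Synthesis

/-! ### Coefficientwise convergence of polynomials -/

/-- Convergence of polynomials of bounded degree. -/
structure PolyTendsto {ι : Type*} (F : Filter ι) (f : ι → ℝ[X]) (g : ℝ[X]) : Prop where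
  bound : ∃ N, ∀ᶠ i in F, (f i).natDegree ≤ N
  coeff : ∀ j, Tendsto (fun i => (f i).coeff j) F (𝓝 (g.coeff j))

namespace PolyTendsto

variable {ι : Type*} {F : Filter ι} {f f' : ι → ℝ[X]} {g g' : ℝ[X]}

lemma const (g : ℝ[X]) : PolyTendsto F (fun _ => g) g :=
  ⟨⟨g.natDegree, Eventually.of_forall fun _ => le_rfl⟩, fun _ => tendsto_const_nhds⟩

lemma of_C {c : ι → ℝ} {c₀ : ℝ} (h : Tendsto c F (𝓝 c₀)) :
    PolyTendsto F (fun i => C (c i)) (C c₀) := by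
  refine ⟨⟨0, Eventually.of_forall fun _ => by simp⟩, fun j => ?_⟩
  simp only [coeff_C]
  split_ifs
  · exact h
  · exact tendsto_const_nhds

lemma sub (h : PolyTendsto F f g) (h' : PolyTendsto F f' g') :
    PolyTendsto F (fun i => f i - f' i) (g - g') := by
  obtain ⟨N, hN⟩ := h.bound
  obtain ⟨N', hN'⟩ := h'.bound
  refine ⟨⟨max N N', ?_⟩, fun j => ?_⟩
  · filter_upwards [hN, hN'] with i h1 h2
    exact (natDegree_sub_le _ _).trans (max_le_max h1 h2)
  · simpa only [coeff_sub] using (h.coeff j).sub (h'.coeff j)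

lemma mul (h : PolyTendsto F f g) (h' : PolyTendsto F f' g') :
    PolyTendsto F (fun i => f i * f' i) (g * g') := by
  obtain ⟨N, hN⟩ := h.bound
  obtain ⟨N', hN'⟩ := h'.bound
  refine ⟨⟨N + N', ?_⟩, fun j => ?_⟩
  · filter_upwards [hN, hN'] with i h1 h2
    exact natDegree_mul_le_of_le h1 h2
  · simp only [coeff_mul]
    exact tendsto_finsetSum _ fun x _ => (h.coeff _).mul (h'.coeff _)

lemma eval (h : PolyTendsto F f g) (x : ℝ) :
    Tendsto (fun i => (f i).eval x) F (𝓝 (g.eval x)) := by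
  obtain ⟨N, hN⟩ := h.bound
  have h1 : g.eval x = ∑ j ∈ Finset.range (max N g.natDegree + 1), g.coeff j * x ^ j :=
    eval_eq_sum_range' (by omega) x
  rw [h1]
  refine Tendsto.congr' ?_ (tendsto_finsetSum (Finset.range (max N g.natDegree + 1))
    fun j _ => (h.coeff j).mul_const (x ^ j))
  filter_upwards [hN] with i hi
  exact (eval_eq_sum_range' (by omega) x).symm

/-- Synthetic division recovers the coefficients from the top down, each from the next higher one;
the degree bound starts the descending induction. -/
lemma divByMonic {a : ℝ} (h : PolyTendsto F f ((X - C a) * g))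
    (ha : ∀ᶠ i in F, (f i).eval a = 0) :
    PolyTendsto F (fun i => f i /ₘ (X - C a)) g := by
  obtain ⟨N, hN⟩ := h.bound
  have hdeg : ∀ᶠ i in F, (f i /ₘ (X - C a)).natDegree ≤ max N g.natDegree := by
    filter_upwards [hN] with i hi
    rw [natDegree_divByMonic _ (monic_X_sub_C a)]
    omega
  refine ⟨⟨_, hdeg⟩, ?_⟩
  have key : ∀ k j, max N g.natDegree < j + k →
      Tendsto (fun i => (f i /ₘ (X - C a)).coeff j) F (𝓝 (g.coeff j)) := by
    intro k
    induction k with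
    | zero =>
      intro j hj
      rw [coeff_eq_zero_of_natDegree_lt (by omega : g.natDegree < j)]
      refine tendsto_const_nhds.congr' ?_
      filter_upwards [hdeg] with i hi
      rw [coeff_eq_zero_of_natDegree_lt (by omega)]
    | succ k ih =>
      intro j hj
      have h1 := (h.coeff (j + 1)).add ((ih (j + 1) (by omega)).mul_const a)
      rw [coeff_X_sub_C_mul, mul_comm a, sub_add_cancel] at h1
      refine h1.congr' ?_
      filter_upwards [ha] with i hi
      have h2 := mul_divByMonic_eq_iff_isRoot.2 (hi : (f i).IsRoot a)
      nth_rewrite 1 [← h2]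
      rw [coeff_X_sub_C_mul, mul_comm a, sub_add_cancel]
  exact fun j => key (max N g.natDegree + 1) j (by omega)

end PolyTendsto

lemma natDegree_divByMonic_X_sub_C_le {f : ℝ[X]} {a : ℝ} {d : ℕ} (h : f.natDegree ≤ d + 1) :
    (f /ₘ (X - C a)).natDegree ≤ d := by
  rw [natDegree_divByMonic _ (monic_X_sub_C a), natDegree_X_sub_C]
  omega

/-! ### Stability of a synthesis under insertion of a zero and a pole -/

section Perturbation

variable {ι : Type*} {F : Filter ι} {x : ℝ} {Z : Finset ℝ}

/-- The nonvanishing and sign conditions are open, and the factor `X - x` does not vanish at `p` or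
on `Z`; it enters the product of the values squared. -/
lemma Admissible.perturb {d : ℕ} {p : ℝ} {u w : ℝ[X]} {U W : ι → ℝ[X]} (hZ : ∀ y ∈ Z, y < x)
    (h : Admissible (insert x Z) d p u w) (hU : PolyTendsto F U ((X - C x) * u))
    (hW : PolyTendsto F W ((X - C x) * w))
    (hd : ∀ᶠ i in F, (U i).natDegree ≤ d + 2 ∧ (W i).natDegree ≤ d + 1) :
    ∀ᶠ i in F, Admissible Z (d + 1) p (U i) (W i) := by
  have hxp : p - x ≠ 0 := sub_ne_zero.2 (h.lt x (Finset.mem_insert_self _ _)).ne'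
  have h1 : ∀ᶠ i in F, (U i).eval p ≠ 0 := by
    apply (hU.eval p).eventually_ne
    simpa [hxp] using h.num_ne
  have h2 : ∀ᶠ i in F, (W i).eval p ≠ 0 := by
    apply (hW.eval p).eventually_ne
    simpa [hxp] using h.den_ne
  have h3 : ∀ᶠ i in F, ∀ y ∈ Z, (U i).eval y * (W i).eval y < 0 := by
    rw [eventually_all_finset]
    intro y hy
    apply ((hU.eval y).mul (hW.eval y)).eventually_lt_const
    have h4 := h.neg y (Finset.mem_insert_of_mem hy)
    have h5 : 0 < (y - x) ^ 2 := sq_pos_of_ne_zero (sub_ne_zero.2 (hZ y hy).ne)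
    simp only [eval_mul, eval_sub, eval_X, eval_C]
    nlinarith
  filter_upwards [h1, h2, h3, hd] with i h1 h2 h3 h4
  exact ⟨h.pos, fun y hy => h.lt y (Finset.mem_insert_of_mem hy), h1, h2, h4.1, h4.2, h3⟩

/-- Splitting off a mass depends continuously on the data. -/
lemma exists_splitMass {f g : ι → ℝ[X]} {q u w : ℝ[X]} {m τ φ : ℝ} {d : ℕ}
    (hf : PolyTendsto F f ((X - C x) * q)) (hg : PolyTendsto F g ((X - C x) * u)) (hm : 0 < m)
    (hq : q = C m * u + (X - C τ) * w) (hxτ : x < τ) (hu : u.eval τ ≠ 0)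
    (hneg : u.eval x * w.eval x < 0)
    (hφ : Tendsto (fun i => (g i).eval x / (f i).eval x) F (𝓝 φ)) (h0 : 0 < φ)
    (h1 : φ < u.eval x / q.eval x) (hsign : ∀ᶠ i in F, (f i).eval x * q.eval x < 0)
    (hd : ∀ᶠ i in F, (f i).natDegree ≤ d + 1 ∧ (g i).natDegree ≤ d + 1) :
    ∃ (μ : ι → ℝ) (h : ι → ℝ[X]) (κ : ℝ),
      (∀ᶠ i in F, 0 < μ i ∧ f i = C (μ i) * g i + (X - C τ) * h i) ∧
      PolyTendsto F h ((X - C x) * w) ∧ (∀ᶠ i in F, (g i).natDegree ≤ d + 1 ∧ (h i).natDegree ≤ d) ∧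
      (∀ᶠ i in F, (h i).eval x * w.eval x < 0) ∧
      Tendsto (fun i => (g i).eval x / (h i).eval x) F (𝓝 κ) ∧
      u.eval x / w.eval x < κ ∧ κ ≤ 0 := by
  have hτx : τ - x ≠ 0 := (sub_pos.2 hxτ).ne'
  have hqτ : q.eval τ = m * u.eval τ := by simp [hq]
  have hqx : q.eval x = m * u.eval x + (x - τ) * w.eval x := by simp [hq]
  have hgτ : ∀ᶠ i in F, (g i).eval τ ≠ 0 := by
    apply (hg.eval τ).eventually_ne
    simpa [hτx] using hu
  have hμ : Tendsto (fun i => (f i).eval τ / (g i).eval τ) F (𝓝 m) := by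
    have := (hf.eval τ).div (hg.eval τ) (by simpa [hτx] using hu)
    have e : ((X - C x) * q).eval τ / ((X - C x) * u).eval τ = m := by
      simp only [eval_mul, eval_sub, eval_X, eval_C, hqτ]
      field_simp
    rwa [e] at this
  have hroot : ∀ᶠ i in F,
      (f i - C ((f i).eval τ / (g i).eval τ) * g i).eval τ = 0 := by
    filter_upwards [hgτ] with i hi
    simp [hi]
  have hlim : PolyTendsto F (fun i => f i - C ((f i).eval τ / (g i).eval τ) * g i)
      ((X - C τ) * ((X - C x) * w)) := by
    have := hf.sub ((PolyTendsto.of_C hμ).mul hg)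
    convert this using 1
    rw [hq]
    ring
  have hh := hlim.divByMonic hroot
  set h : ι → ℝ[X] := fun i => (f i - C ((f i).eval τ / (g i).eval τ) * g i) /ₘ (X - C τ) with hhdef
  have heq : ∀ᶠ i in F, f i = C ((f i).eval τ / (g i).eval τ) * g i + (X - C τ) * h i := by
    filter_upwards [hroot] with i hi
    rw [hhdef]
    simp only
    rw [mul_divByMonic_eq_iff_isRoot.2 hi]
    ring
  have hux : u.eval x ≠ 0 := left_ne_zero_of_mul hneg.ne
  have hwx : w.eval x ≠ 0 := right_ne_zero_of_mul hneg.ne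
  have hqx0 : q.eval x ≠ 0 := fun h' => by rw [h', div_zero] at h1; linarith
  have hψ : 0 < u.eval x / q.eval x := h0.trans h1
  have hr : (x - τ) * w.eval x / q.eval x = 1 - m * (u.eval x / q.eval x) := by
    field_simp
    linarith
  -- Here `u(x) w(x) < 0` enters. As `φ` is smaller than `u(x) / q(x)`, positivity passes to `1 - m
  -- φ`, so `h` does not vanish at `x` eventually.
  have hr0 : 0 < 1 - m * (u.eval x / q.eval x) := by
    rw [← hr]
    have e : (x - τ) * w.eval x / q.eval x =
        (u.eval x / q.eval x) * ((τ - x) * -(u.eval x * w.eval x)) / (u.eval x) ^ 2 := by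
      field_simp
      ring
    rw [e]
    exact div_pos (mul_pos hψ (mul_pos (sub_pos.2 hxτ) (by linarith))) (sq_pos_of_ne_zero hux)
  have hr1 : 0 < 1 - m * φ := by nlinarith
  have hfx : ∀ᶠ i in F, (f i).eval x ≠ 0 := hsign.mono fun i hi => left_ne_zero_of_mul hi.ne
  have hhx : ∀ᶠ i in F, (x - τ) * (h i).eval x = (f i).eval x *
      (1 - (f i).eval τ / (g i).eval τ * ((g i).eval x / (f i).eval x)) := by
    filter_upwards [heq, hfx] with i h2 h3
    have h4 := congrArg (eval x) h2
    simp only [eval_add, eval_mul, eval_C, eval_sub, eval_X] at h4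
    have h5 : (f i).eval x * (1 - (f i).eval τ / (g i).eval τ * ((g i).eval x / (f i).eval x)) =
        (f i).eval x - (f i).eval τ / (g i).eval τ * (g i).eval x := by
      rw [mul_sub, mul_one, mul_left_comm, mul_div_cancel₀ _ h3]
    rw [h5]
    linarith
  have hpos : ∀ᶠ i in F,
      0 < 1 - (f i).eval τ / (g i).eval τ * ((g i).eval x / (f i).eval x) :=
    (tendsto_const_nhds.sub (hμ.mul hφ)).eventually_const_lt hr1
  -- The map `s ↦ (x - τ) s / (1 - m s)` takes the limit of `g / f` at `x` to that of `g / h`, and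
  -- takes `u / q` to `u / w`. It is decreasing because `x < τ`, which reverses the strict
  -- inequality.
  refine ⟨fun i => (f i).eval τ / (g i).eval τ, h, (x - τ) * (φ / (1 - m * φ)), ?_, hh, ?_, ?_, ?_,
    ?_, ?_⟩
  · filter_upwards [heq, hμ.eventually_const_lt hm] with i h2 h3
    exact ⟨h3, h2⟩
  · filter_upwards [hd] with i hi
    exact ⟨hi.2, natDegree_divByMonic_X_sub_C_le (natDegree_sub_le_of_le hi.1
      ((natDegree_C_mul_le _ _).trans hi.2) |>.trans (by simp))⟩
  · filter_upwards [hhx, hpos, hsign] with i h2 h3 h4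
    have h5 : (x - τ) * w.eval x = q.eval x * (1 - m * (u.eval x / q.eval x)) := by
      rw [← hr]
      field_simp
    have h6 : (x - τ) ^ 2 * ((h i).eval x * w.eval x) < 0 := by
      have : (x - τ) ^ 2 * ((h i).eval x * w.eval x) =
          ((x - τ) * (h i).eval x) * ((x - τ) * w.eval x) := by ring
      rw [this, h2, h5, mul_mul_mul_comm]
      exact mul_neg_of_neg_of_pos h4 (mul_pos h3 hr0)
    exact neg_of_mul_neg_right h6 (sq_nonneg _)
  · have := (tendsto_const_nhds (x := x - τ)).mul
      (hφ.div (tendsto_const_nhds.sub (hμ.mul hφ)) hr1.ne')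
    refine this.congr' ?_
    filter_upwards [hhx, hpos, hfx] with i h2 h3 h4
    have h5 : (h i).eval x ≠ 0 := by
      intro h6
      rw [h6, mul_zero] at h2
      exact mul_ne_zero h4 h3.ne' h2.symm
    have h7 : x - τ ≠ 0 := (sub_neg.2 hxτ).ne
    simp only [Pi.div_apply]
    rw [mul_div_assoc', div_eq_div_iff h3.ne' h5, mul_right_comm, h2, mul_comm, ← mul_assoc,
      div_mul_cancel₀ _ h4]
  · have h2 : u.eval x / w.eval x =
        (x - τ) * ((u.eval x / q.eval x) / (1 - m * (u.eval x / q.eval x))) := by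
      have h7 : x - τ ≠ 0 := (sub_neg.2 hxτ).ne
      rw [← hr]
      field_simp
    rw [h2]
    apply mul_lt_mul_of_neg_left _ (sub_neg.2 hxτ)
    rw [div_lt_div_iff₀ hr1 hr0]
    linarith
  · exact mul_nonpos_of_nonpos_of_nonneg (sub_neg.2 hxτ).le (div_pos h0 hr1).le

/-- Splitting off a whole pole depends continuously on the data. -/
lemma exists_splitPole (hx : 0 < x) {d : ℕ} {p g κ : ℝ} {u w u' : ℝ[X]} {U W : ι → ℝ[X]}
    (hg : 0 < g) (hu : u = (X - C p) * u' + C g * X * w) (hA : Admissible (insert x Z) d p u w)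
    (hU : PolyTendsto F U ((X - C x) * u)) (hW : PolyTendsto F W ((X - C x) * w))
    (hd : ∀ᶠ i in F, (U i).natDegree ≤ d + 2 ∧ (W i).natDegree ≤ d + 1)
    (hsign : ∀ᶠ i in F, (W i).eval x * w.eval x < 0)
    (hκ : Tendsto (fun i => (U i).eval x / (W i).eval x) F (𝓝 κ))
    (hκ1 : u.eval x / w.eval x < κ) (hκ0 : κ ≤ 0) :
    ∃ (γ : ι → ℝ) (U' : ι → ℝ[X]) (φ : ℝ),
      (∀ᶠ i in F, 0 < γ i ∧ U i = (X - C p) * U' i + C (γ i) * X * W i) ∧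
      PolyTendsto F U' ((X - C x) * u') ∧
      (∀ᶠ i in F, (W i).natDegree ≤ d + 1 ∧ (U' i).natDegree ≤ d + 1) ∧
      Tendsto (fun i => (U' i).eval x / (W i).eval x) F (𝓝 φ) ∧ 0 < φ ∧
      φ < u'.eval x / w.eval x := by
  have hp := hA.pos
  have hxp : x < p := hA.lt x (Finset.mem_insert_self _ _)
  have hpx : p - x ≠ 0 := (sub_pos.2 hxp).ne'
  have hxp' : x - p ≠ 0 := (sub_neg.2 hxp).ne
  have hlimW : ((X - C x) * w).eval p ≠ 0 := by simpa [hpx] using hA.den_ne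
  have hWp : ∀ᶠ i in F, (W i).eval p ≠ 0 := (hW.eval p).eventually_ne hlimW
  have hγ : Tendsto (fun i => (U i).eval p / (p * (W i).eval p)) F (𝓝 g) := by
    have := (hU.eval p).div ((hW.eval p).const_mul p) (mul_ne_zero hp.ne' hlimW)
    have e : ((X - C x) * u).eval p / (p * ((X - C x) * w).eval p) = g := by
      have := hA.den_ne
      have hup : u.eval p = g * p * w.eval p := by simp [hu]
      simp only [eval_mul, eval_sub, eval_X, eval_C, hup]
      field_simp
    rwa [e] at this
  have hroot : ∀ᶠ i in F,
      (U i - C ((U i).eval p / (p * (W i).eval p)) * X * W i).eval p = 0 := by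
    filter_upwards [hWp] with i hi
    simp
    field_simp
    ring
  have hlim : PolyTendsto F (fun i => U i - C ((U i).eval p / (p * (W i).eval p)) * X * W i)
      ((X - C p) * ((X - C x) * u')) := by
    have := hU.sub (((PolyTendsto.of_C hγ).mul (PolyTendsto.const X)).mul hW)
    convert this using 1
    rw [hu]
    ring
  have hh := hlim.divByMonic hroot
  set U' : ι → ℝ[X] :=
    fun i => (U i - C ((U i).eval p / (p * (W i).eval p)) * X * W i) /ₘ (X - C p) with hU'
  have heq : ∀ᶠ i in F,
      U i = (X - C p) * U' i + C ((U i).eval p / (p * (W i).eval p)) * X * W i := by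
    filter_upwards [hroot] with i hi
    rw [hU']
    simp only
    rw [mul_divByMonic_eq_iff_isRoot.2 hi]
    ring
  have hwx : w.eval x ≠ 0 :=
    right_ne_zero_of_mul (hA.neg x (Finset.mem_insert_self _ _)).ne
  refine ⟨fun i => (U i).eval p / (p * (W i).eval p), U', (κ - g * x) / (x - p), ?_, hh, ?_, ?_, ?_, ?_⟩
  · filter_upwards [heq, hγ.eventually_const_lt hg] with i h1 h2
    exact ⟨h2, h1⟩
  · filter_upwards [hd] with i hi
    refine ⟨hi.2, natDegree_divByMonic_X_sub_C_le ?_⟩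
    have h1 : (C ((U i).eval p / (p * (W i).eval p)) * X : ℝ[X]).natDegree ≤ 1 :=
      natDegree_C_mul_le _ _ |>.trans natDegree_X_le
    exact (natDegree_sub_le_of_le hi.1 (natDegree_mul_le_of_le h1 hi.2)).trans
      (max_le le_rfl (by omega))
  · refine ((hκ.sub (hγ.mul_const x)).div_const (x - p)).congr' ?_
    filter_upwards [heq, hsign] with i h1 h2
    have h3 : (W i).eval x ≠ 0 := left_ne_zero_of_mul h2.ne
    have h4 := congrArg (eval x) h1
    simp only [eval_add, eval_mul, eval_C, eval_sub, eval_X] at h4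
    rw [div_eq_div_iff hxp' h3, sub_mul, div_mul_cancel₀ _ h3]
    linarith
  -- Since `g x > 0`, even `κ = 0` gives a strict inequality.
  · exact div_pos_of_neg_of_neg (by nlinarith) (sub_neg.2 hxp)
  · have e : u'.eval x / w.eval x = (u.eval x / w.eval x - g * x) / (x - p) := by
      rw [hu]
      simp only [eval_add, eval_mul, eval_C, eval_sub, eval_X]
      field_simp
      ring
    rw [e]
    exact div_lt_div_of_neg_of_lt (sub_neg.2 hxp) (by linarith)

/-- A synthesis persists if a pair of a zero and a pole slightly beyond it are inserted at the
point `x` below the other zeros and poles. The additional pole is used at the end of the synthesis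
for one partial step at each of the points of the list `l`. -/
theorem Synthesis.perturb {fin : ℝ} {l : List ℝ} (hx : 0 < x) (hZ : ∀ y ∈ Z, y < x)
    (hxf : x < fin) (hl : ∀ s ∈ l, x < s ∧ s < fin) (hl' : l.Pairwise (· < ·)) {d n : ℕ}
    {D u w : ℝ[X]} {p : ℝ} (h : Synthesis (insert x Z) d D n p u w) :
    ∀ {U W : ι → ℝ[X]} {κ : ℝ}, PolyTendsto F U ((X - C x) * u) →
      PolyTendsto F W ((X - C x) * w) →
      (∀ᶠ i in F, (U i).natDegree ≤ d + 2 ∧ (W i).natDegree ≤ d + 1) →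
      (∀ᶠ i in F, (W i).eval x * w.eval x < 0) →
      Tendsto (fun i => (U i).eval x / (W i).eval x) F (𝓝 κ) →
      u.eval x / w.eval x < κ → κ ≤ 0 →
      ∀ᶠ i in F, Synthesis Z (d + 1) (D * (l.map fun s => X - C s).prod) (n + (l.length + 1)) p
        (U i) (W i) := by
  -- Near `x` the polynomials `U` and `W` have one zero each. The sign condition puts the zero of
  -- `W` above `x`; the ratio of the offsets of the two zeros from `x` tends to `κ w(x) / u(x)`,
  -- which lies in `[0, 1)`. These conditions reproduce themselves at every step while all poles `p`
  -- stay fixed.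
  induction h with
  | @last a c g p u hac hg hu hA =>
    intro U W κ hU hW hd hsign hκ hκ1 hκ0
    have hAd := hA.perturb hZ hU hW hd
    obtain ⟨γ, U', φ, h1, hU', hd', hφ, hφ0, hφ1⟩ :=
      exists_splitPole hx hg hu hA hU hW hd hsign hκ hκ1 hκ0
    have ha : a ≠ 0 := left_ne_zero_of_mul hac.ne'
    have hc : c ≠ 0 := right_ne_zero_of_mul hac.ne'
    have hca : 0 < c / a := by
      rw [← mul_div_mul_right _ _ ha, mul_comm c a]
      exact div_pos hac (mul_self_pos.2 ha)
    have hcoef : ∀ e : ℝ, ((X - C x) * C e).coeff 1 = e := fun e => by simp [coeff_X]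
    have hal : Tendsto (fun i => (U' i).coeff 1) F (𝓝 a) := hcoef a ▸ hU'.coeff 1
    have hcl : Tendsto (fun i => (W i).coeff 1) F (𝓝 c) := hcoef c ▸ hW.coeff 1
    have hWx : Tendsto (fun i => (W i).eval x) F (𝓝 0) := by simpa using hW.eval x
    have hpole : Tendsto (fun i => x - (W i).eval x / (W i).coeff 1) F (𝓝 x) := by
      simpa using (tendsto_const_nhds (x := x)).sub (hWx.div hcl hc)
    have e1 : ∀ᶠ i in F, 0 < (U' i).coeff 1 * (W i).coeff 1 := (hal.mul hcl).eventually_const_lt hac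
    have e2 : ∀ᶠ i in F, 0 < c * (W i).coeff 1 :=
      (hcl.const_mul c).eventually_const_lt (mul_self_pos.2 hc)
    -- This ratio of the offsets from `x` of the zeros of the now linear `U'` and `W` has its limit
    -- strictly in `(0, 1)`; so eventually the zero of `U'` lies between `x` and that of `W`, as
    -- `Synthesis.exists_of_linear` requires.
    have hρ := hφ.mul (hcl.div hal ha)
    have e3 : ∀ᶠ i in F, 0 < (U' i).eval x / (W i).eval x * ((W i).coeff 1 / (U' i).coeff 1) :=
      hρ.eventually_const_lt (mul_pos hφ0 hca)
    have e4 : ∀ᶠ i in F, (U' i).eval x / (W i).eval x * ((W i).coeff 1 / (U' i).coeff 1) < 1 := by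
      apply hρ.eventually_lt_const
      simp only [eval_C] at hφ1
      calc φ * (c / a) < a / c * (c / a) := mul_lt_mul_of_pos_right hφ1 hca
        _ = 1 := by field_simp
    have e5 : ∀ᶠ i in F, ∀ s ∈ insert fin l.toFinset, x - (W i).eval x / (W i).coeff 1 < s := by
      rw [eventually_all_finset]
      intro s hs
      apply hpole.eventually_lt_const
      rcases Finset.mem_insert.1 hs with rfl | hs
      · exact hxf
      · exact (hl s (List.mem_toFinset.1 hs)).1
    filter_upwards [hAd, h1, hd', hsign, e1, e2, e3, e4, e5] with i hA' h1 hd' hs e1 e2 e3 e4 e5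
    have hai : (U' i).coeff 1 ≠ 0 := left_ne_zero_of_mul e1.ne'
    have hci : (W i).coeff 1 ≠ 0 := right_ne_zero_of_mul e1.ne'
    have hlin : ∀ f : ℝ[X], f.natDegree ≤ 1 → f.coeff 1 ≠ 0 →
        f = C (f.coeff 1) * (X - C (x - f.eval x / f.coeff 1)) := by
      intro f hf hf1
      have h3 := eq_X_add_C_of_natDegree_le_one hf
      have h4 : f.eval x = f.coeff 1 * x + f.coeff 0 := by
        conv_lhs => rw [h3]
        simp
      have h5 : f.coeff 0 = f.coeff 1 * (f.eval x / f.coeff 1 - x) := by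
        rw [mul_sub, mul_div_cancel₀ _ hf1, h4]
        ring
      conv_lhs => rw [h3, h5]
      simp only [C_mul, C_sub]
      ring
    have hω : (W i).eval x / (W i).coeff 1 < 0 := by
      have h3 : (W i).eval x / (W i).coeff 1 * (c * (W i).coeff 1) < 0 := by
        rw [mul_left_comm, div_mul_cancel₀ _ hci, mul_comm]
        simpa using hs
      exact neg_of_mul_neg_left h3 e2.le
    have hWne : (W i).eval x ≠ 0 := left_ne_zero_of_mul hs.ne
    have hz : (U' i).eval x / (U' i).coeff 1 =
        (U' i).eval x / (W i).eval x * ((W i).coeff 1 / (U' i).coeff 1) *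
          ((W i).eval x / (W i).coeff 1) := by
      field_simp
    have hz0 : x < x - (U' i).eval x / (U' i).coeff 1 := by
      have := mul_neg_of_pos_of_neg e3 hω
      rw [← hz] at this
      linarith
    have hzp : x - (U' i).eval x / (U' i).coeff 1 < x - (W i).eval x / (W i).coeff 1 := by
      have := mul_lt_mul_of_neg_right e4 hω
      rw [← hz] at this
      linarith
    obtain ⟨q, m, w', hm, hw', hS⟩ := Synthesis.exists_of_linear Z fin l e1 (hx.trans hz0) hzp
      (e5 fin (Finset.mem_insert_self _ _)) (fun y hy => (hZ y hy).trans hz0)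
      (fun s hs => ⟨e5 s (Finset.mem_insert_of_mem (List.mem_toFinset.2 hs)), (hl s hs).2⟩) hl'
    rw [← hlin _ hd'.2 hai] at hw' hS
    rw [← hlin _ hd'.1 hci] at hw'
    rw [one_mul, add_comm 1 (l.length + 1)]
    exact Synthesis.full hm h1.1 h1.2 hw' hA' hS
  | @full d n D u w u' w' m g p q hm hg hu hw hA h ih =>
    intro U W κ hU hW hd hsign hκ hκ1 hκ0
    have hA' := h.admissible
    have hxZ := Finset.mem_insert_self x Z
    have hAd := hA.perturb hZ hU hW hd
    obtain ⟨γ, U', φ, h1, hU', hd', hφ, hφ0, hφ1⟩ :=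
      exists_splitPole hx hg hu hA hU hW hd hsign hκ hκ1 hκ0
    obtain ⟨μ, W', κ', h2, hW', hd'', hsign', hκ', hκ1', hκ0'⟩ :=
      exists_splitMass hW hU' hm hw (hA'.lt x hxZ) hA'.num_ne (hA'.neg x hxZ) hφ hφ0 hφ1 hsign hd'
    filter_upwards [ih hU' hW' hd'' hsign' hκ' hκ1' hκ0', hAd, h1, h2] with i h3 h4 h5 h6
    rw [add_right_comm n 1]
    exact Synthesis.full h6.1 h5.1 h5.2 h6.2 h4 h3
  | @part d n D u w u' w' m g p q hm hg hu hw hA h ih =>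
    intro U W κ hU hW hd hsign hκ hκ1 hκ0
    have hA' := h.admissible
    have hxZ := Finset.mem_insert_self x Z
    have hAd := hA.perturb hZ hU hW hd
    have hxp : x < p := hA.lt x hxZ
    have hxp' : x - p ≠ 0 := (sub_neg.2 hxp).ne
    have hwx : w.eval x ≠ 0 := right_ne_zero_of_mul (hA.neg x hxZ).ne
    -- The constant `g` of a partial step can be kept, since the pole need not cancel.
    have hU' : PolyTendsto F (fun i => U i - C g * X * W i) ((X - C x) * u') := by
      have := hU.sub ((PolyTendsto.const (C g * X)).mul hW)
      convert this using 1
      rw [hu]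
      ring
    have hq : PolyTendsto F (fun i => (X - C p) * W i) ((X - C x) * ((X - C p) * w)) := by
      have := (PolyTendsto.const (X - C p)).mul hW
      convert this using 1
      ring
    have hφ : Tendsto (fun i => (U i - C g * X * W i).eval x / ((X - C p) * W i).eval x) F
        (𝓝 ((κ - g * x) / (x - p))) := by
      refine ((hκ.sub_const (g * x)).div_const (x - p)).congr' ?_
      filter_upwards [hsign] with i h2
      have h3 : (W i).eval x ≠ 0 := left_ne_zero_of_mul h2.ne
      simp only [eval_mul, eval_C, eval_sub, eval_X]
      field_simp
    have hφ0 : 0 < (κ - g * x) / (x - p) :=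
      div_pos_of_neg_of_neg (by nlinarith) (sub_neg.2 hxp)
    have hφ1 : (κ - g * x) / (x - p) < u'.eval x / ((X - C p) * w).eval x := by
      have e : u'.eval x / ((X - C p) * w).eval x = (u.eval x / w.eval x - g * x) / (x - p) := by
        rw [hu]
        simp only [eval_add, eval_mul, eval_C, eval_sub, eval_X]
        field_simp
        ring
      rw [e]
      exact div_lt_div_of_neg_of_lt (sub_neg.2 hxp) (by linarith)
    have hs : ∀ᶠ i in F, ((X - C p) * W i).eval x * ((X - C p) * w).eval x < 0 := by
      filter_upwards [hsign] with i hi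
      simp only [eval_mul, eval_C, eval_sub, eval_X]
      rw [mul_mul_mul_comm]
      exact mul_neg_of_pos_of_neg (mul_self_pos.2 hxp') hi
    have hd' : ∀ᶠ i in F, ((X - C p) * W i).natDegree ≤ d + 1 + 1 ∧
        (U i - C g * X * W i).natDegree ≤ d + 1 + 1 := by
      have hgX : (C g * X : ℝ[X]).natDegree ≤ 1 := (natDegree_C_mul_le _ _).trans natDegree_X_le
      filter_upwards [hd] with i hi
      refine ⟨(natDegree_mul_le_of_le (natDegree_X_sub_C_le _) hi.2).trans (by omega), ?_⟩
      exact (natDegree_sub_le_of_le hi.1 (natDegree_mul_le_of_le hgX hi.2)).trans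
        (max_le le_rfl (by omega))
    obtain ⟨μ, W', κ', h2, hW', hd'', hsign', hκ', hκ1', hκ0'⟩ :=
      exists_splitMass hq hU' hm hw (hA'.lt x hxZ) hA'.num_ne (hA'.neg x hxZ) hφ hφ0 hφ1 hs hd'
    filter_upwards [ih hU' hW' hd'' hsign' hκ' hκ1' hκ0', hAd, h2] with i h3 h4 h6
    rw [add_right_comm n 1, mul_assoc]
    exact Synthesis.part h6.1 hg (by ring) h6.2 h4 h3

end Perturbation

/-! ### Sufficiency: induction on the number of zeros -/

/-- The set `Z` reserves the points below `lam 0` at which zeros are to be inserted later; the sign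
condition on `Z` in every state makes those insertions possible. -/
lemma exists_synthesis : ∀ (m : ℕ) (lam : Fin (m + 1) → ℝ) (r : Fin (m + 1) → ℕ),
    (∀ i, 0 < lam i) → StrictMono lam → (∀ i, r i ≤ i) →
    ∀ Z : Finset ℝ, (∀ y ∈ Z, y < lam 0) →
    ∃ n p w, Synthesis Z m (∏ i, (X - C (lam i)) ^ r i) n p (∏ i, (X - C (lam i))) w
  | 0, lam, r, hpos, _, hr, Z, hZ => by
    have h0 := hpos 0
    have hr0 : r 0 = 0 := Nat.le_zero.1 (hr 0)
    have h1 : 0 < lam 0 + 1 := by linarith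
    refine ⟨1, lam 0 + 1, C 1, ?_⟩
    have e1 : ∏ i, (X - C (lam i)) ^ r i = 1 := by
      rw [Fin.prod_univ_succ, hr0, pow_zero, one_mul, Fin.prod_univ_zero]
    have e2 : ∏ i, (X - C (lam i)) = X - C (lam 0) := by
      rw [Fin.prod_univ_succ, Fin.prod_univ_zero, mul_one]
    rw [e1, e2]
    refine Synthesis.last (a := lam 0 / (lam 0 + 1)) (g := 1 / (lam 0 + 1))
      (by rw [mul_one]; exact div_pos h0 h1) (div_pos one_pos h1) ?_ ?_
    · apply Polynomial.funext
      intro x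
      simp
      field_simp
      ring
    · exact ⟨h1, fun y hy => by linarith [hZ y hy], by simp, by simp,
        (natDegree_X_sub_C_le _), (natDegree_C _).le, fun y hy => by simpa using hZ y hy⟩
  | m + 1, lam, r, hpos, hlam, hr, Z, hZ => by
    have hlt : ∀ i : Fin (m + 1), lam 0 < lam i.succ := fun i => hlam (Fin.succ_pos i)
    -- The subtraction is truncated: exponents that are already zero stay zero, and the list `l` of
    -- additional partial steps omits their indices.
    obtain ⟨n, p, w, hS⟩ := exists_synthesis m (fun i => lam i.succ) (fun i => r i.succ - 1)
      (fun i => hpos _) (fun i j hij => hlam (Fin.succ_lt_succ_iff.2 hij))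
      (fun i => by have := hr i.succ; rw [Fin.val_succ] at this; omega)
      (insert (lam 0) Z) (by
        intro y hy
        rcases Finset.mem_insert.1 hy with rfl | hy
        · exact hlt 0
        · exact (hZ y hy).trans (hlt 0))
    set l : List ℝ := ((List.finRange (m + 1)).filter fun i => 1 ≤ r i.succ).map
      fun i => lam i.succ with hl
    have hA := hS.admissible
    have hneg := hA.neg _ (Finset.mem_insert_self _ _)
    set u : ℝ[X] := ∏ i : Fin (m + 1), (X - C (lam i.succ)) with hu
    have hwx : w.eval (lam 0) ≠ 0 := right_ne_zero_of_mul hneg.ne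
    have hux : u.eval (lam 0) / w.eval (lam 0) < 0 := by
      have e : u.eval (lam 0) / w.eval (lam 0) =
          (u.eval (lam 0) * w.eval (lam 0)) / w.eval (lam 0) ^ 2 := by field_simp
      rw [e]
      exact div_neg_of_neg_of_pos hneg (sq_pos_of_ne_zero hwx)
    have hev : ∀ᶠ ε in 𝓝[>] (0 : ℝ), Synthesis Z (m + 1)
        ((∏ i : Fin (m + 1), (X - C (lam i.succ)) ^ (r i.succ - 1)) *
          (l.map fun s => X - C s).prod) (n + (l.length + 1)) p ((X - C (lam 0)) * u)
        ((X - C (lam 0 + ε)) * w) := by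
      have hε : Tendsto (fun ε : ℝ => ε) (𝓝[>] 0) (𝓝 0) := tendsto_nhdsWithin_of_tendsto_nhds
        tendsto_id
      -- Here `κ = 0` because the inserted zero lies exactly at `lam 0`; `fin` is any point beyond
      -- all zeros, the last pole of the chain.
      refine Synthesis.perturb (x := lam 0) (fin := lam (Fin.last _) + 1) (κ := 0) (hpos 0) hZ ?_
        ?_ ?_ hS (PolyTendsto.const _) ?_ ?_ ?_ ?_ hux le_rfl
      · linarith [hlam.monotone (Fin.zero_le (Fin.last (m + 1)))]
      · intro s hs
        obtain ⟨i, -, rfl⟩ := List.mem_map.1 hs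
        exact ⟨hlt i, by linarith [hlam.monotone (Fin.le_last i.succ)]⟩
      · rw [hl, List.pairwise_map]
        exact ((List.pairwise_lt_finRange _).filter _).imp fun h =>
          hlam (Fin.succ_lt_succ_iff.2 h)
      · have := ((PolyTendsto.const X).sub
          (PolyTendsto.of_C ((tendsto_const_nhds (x := lam 0)).add hε))).mul (PolyTendsto.const w)
        rwa [add_zero] at this
      · refine Eventually.of_forall fun ε => ⟨?_, ?_⟩
        · exact (natDegree_mul_le_of_le (natDegree_X_sub_C_le _) hA.natDegree_num).trans (by omega)
        · exact (natDegree_mul_le_of_le (natDegree_X_sub_C_le _) hA.natDegree_den).trans (by omega)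
      · filter_upwards [self_mem_nhdsWithin] with ε hε
        have h1 : 0 < ε := hε
        have h2 := mul_self_pos.2 hwx
        have h3 := mul_pos h1 h2
        simp only [eval_mul, eval_sub, eval_X, eval_C]
        linarith
      · simp
    obtain ⟨ε, hε⟩ := hev.exists
    refine ⟨n + (l.length + 1), p, (X - C (lam 0 + ε)) * w, ?_⟩
    rw [Fin.prod_univ_succ fun i => (X - C (lam i)) ^ r i,
      Fin.prod_univ_succ fun i => X - C (lam i)]
    convert hε using 1
    have hr0 : r 0 = 0 := Nat.le_zero.1 (hr 0)
    have hlist : (l.map fun s => (X - C s : ℝ[X])).prod =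
        ∏ i : Fin (m + 1), (X - C (lam i.succ)) ^ (if 1 ≤ r i.succ then 1 else 0) := by
      rw [Fin.prod_univ_def, hl, List.map_map]
      induction List.finRange (m + 1) with
      | nil => rfl
      | cons i L ih =>
        by_cases hi : 1 ≤ r i.succ
        · simp [hi, ih]
        · simp [hi, ih]
    rw [hr0, pow_zero, one_mul, hlist, ← Finset.prod_mul_distrib]
    refine Finset.prod_congr rfl fun i _ => ?_
    rw [← pow_add]
    congr 1
    split_ifs with h <;> omega

theorem exists_chain_of_multiplicity_le {m n : ℕ} {lam : Fin m → ℝ} {t : Fin m → ℕ}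
    (hpos : ∀ i, 0 < lam i) (hlam : StrictMono lam) (ht : ∀ i, 1 ≤ t i) (hsum : ∑ i, t i = n)
    (hle : ∀ i : Fin m, t i ≤ (i : ℕ) + 1) :
    ∃ mass k b : Fin n → ℝ, (∀ j, 0 < mass j) ∧ (∀ j, 0 < k j) ∧ (∀ j, 0 ≤ b j) ∧
      ∏ i, (X - C (lam i)) ^ t i ∣ pencilDet mass k b := by
  rcases m with _ | m
  · exact ⟨fun _ => 1, fun _ => 1, fun _ => 1, fun _ => one_pos, fun _ => one_pos,
      fun _ => zero_le_one, by simp⟩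
  -- One factor at each `lam i` comes from the numerator, so `D` carries only `t i - 1` of them.
  obtain ⟨n', p, w, hS⟩ := exists_synthesis m lam (fun i => t i - 1) hpos hlam
    (fun i => by have := hle i; omega) ∅ (by simp)
  have hn : n' = n := by
    rw [hS.length_eq, natDegree_prod_of_monic _ _ fun j _ => (monic_X_sub_C _).pow _, ← hsum]
    have h1 : ∑ i, t i = ∑ i : Fin (m + 1), ((t i - 1) + 1) :=
      Finset.sum_congr rfl fun i _ => (Nat.sub_add_cancel (ht i)).symm
    rw [h1, Finset.sum_add_distrib]
    simp [add_assoc]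
  subst hn
  obtain ⟨mass, k, b, h1, h2, h3, c, hc, h4⟩ := hS.chainRealizes
  refine ⟨mass, k, b, h1, h2, h3, ?_⟩
  rw [pencilDet_eq_chainPair, h4]
  have h5 : ∏ i, (X - C (lam i)) ^ t i =
      (∏ i, (X - C (lam i)) ^ (t i - 1)) * ∏ i, (X - C (lam i)) := by
    rw [← Finset.prod_mul_distrib]
    refine Finset.prod_congr rfl fun i _ => ?_
    rw [← pow_succ, Nat.sub_add_cancel (ht i)]
  rw [h5]
  exact Dvd.intro_left _ rfl

theorem theorem1 (m n : ℕ) (lam : Fin m → ℝ) (t : Fin m → ℕ)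
    (hpos : ∀ i, 0 < lam i) (hlam : StrictMono lam)
    (ht : ∀ i, 1 ≤ t i) (hsum : ∑ i, t i = n) :
    (∃ mass k b : Fin n → ℝ,
      (∀ j, 0 < mass j) ∧ (∀ j, 0 < k j) ∧ (∀ j, 0 ≤ b j) ∧
      ∏ i, (X - C (lam i)) ^ t i ∣ pencilDet mass k b) ↔
    ∀ i : Fin m, t i ≤ (i : ℕ) + 1 := by
  refine ⟨?_, exists_chain_of_multiplicity_le hpos hlam ht hsum⟩
  rintro ⟨mass, k, b, hm, hk, hb, hdvd⟩
  exact multiplicity_le_of_dvd_pencilDet hpos hlam ht hsum hm hk hb hdvd
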